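/- Let $K$ be a field of characteristic different from $2$ and $3$, and let $L=L_{\bar 0}\oplus L_{\bar 1}$ be a nilpotent Lie superalgebra over $K$ of dimension $(m\mid n)$, that is, $\dim_K L_{\bar 0}=m$ and $\dim_K L_{\bar 1}=n$. Suppose that $m+n\ge 4$, $n\ge 1$, and that the derived subsuperalgebra $L^2=[L,L]$ has dimension $m+n-2$. Let $L\cong F/R$ be a presentation of $L$ with $F$ a free Lie superalgebra (on a set of even and odd generators), and let $$\mathcal M(L)=(R\cap F^2)/[R,F]$$ be the Schur multiplier of $L$. Then $\mathcal M(L)$ is finite-dimensional and $\dim_K \mathcal M(L)<m+2n-3$. -/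

import Mathlib

/-- The sign `(-1)^{ij}` for parities `i, j ∈ ℤ/2`, as a scalar of `K`. -/
def superSign (K : Type*) [Field K] (i j : ZMod 2) : K := (-1) ^ (i.val * j.val)

/-- A Lie superalgebra structure on the `K`-vector space `L`: a `ℤ/2`-grading `L = L₀ ⊕ L₁` and an
even bilinear bracket that is super skew-symmetric and satisfies the super Jacobi identity.
(This is the usual definition over a field of characteristic different from 2 and 3.) -/
class LieSuperalgebra (K : Type*) (L : Type*) [Field K] [AddCommGroup L] [Module K L] where
  /-- the homogeneous components `gr 0 = L₀` and `gr 1 = L₁` -/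
  gr : ZMod 2 → Submodule K L
  /-- `L` is the internal direct sum of `L₀` and `L₁` -/
  isCompl_gr : IsCompl (gr 0) (gr 1)
  /-- the bracket -/
  bracket : L →ₗ[K] L →ₗ[K] L
  bracket_mem : ∀ {i j : ZMod 2} {x y : L}, x ∈ gr i → y ∈ gr j → bracket x y ∈ gr (i + j)
  skew : ∀ {i j : ZMod 2} {x y : L}, x ∈ gr i → y ∈ gr j →
    bracket x y = -(superSign K i j • bracket y x)
  jacobi : ∀ {i j k : ZMod 2} {x y z : L}, x ∈ gr i → y ∈ gr j → z ∈ gr k →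
    bracket x (bracket y z) = bracket (bracket x y) z + superSign K i j • bracket y (bracket x z)

namespace LieSuperalgebra

section Basic

variable (K : Type*) (L : Type*) [Field K] [AddCommGroup L] [Module K L] [LieSuperalgebra K L]

variable {L} in
/-- `[A, B]`, the span of all brackets `[a, b]` with `a ∈ A` and `b ∈ B`. -/
def bracketSpan (A B : Submodule K L) : Submodule K L :=
  Submodule.map₂ (bracket (K := K) (L := L)) A B

/-- The derived subsuperalgebra `L² = [L, L]`. -/
def derived : Submodule K L := bracketSpan K ⊤ ⊤

/-- The lower central series `C⁰(L) = L`, `Cⁱ⁺¹(L) = [L, Cⁱ(L)]`. -/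
def lowerCentral : ℕ → Submodule K L
  | 0 => ⊤
  | i + 1 => bracketSpan K ⊤ (lowerCentral i)

/-- `L` is nilpotent if some term of its lower central series vanishes. -/
def IsNilpotent : Prop := ∃ c : ℕ, lowerCentral K L c = ⊥

/-- `L` has (super)dimension `(m | n)`. -/
def HasSuperdim (m n : ℕ) : Prop :=
  Module.Finite K L ∧ Module.finrank K (gr (K := K) (L := L) 0) = m ∧
    Module.finrank K (gr (K := K) (L := L) 1) = n

/-- Homomorphisms of Lie superalgebras: linear, parity preserving and compatible with brackets. -/
structure Hom (L' : Type*) [AddCommGroup L'] [Module K L'] [LieSuperalgebra K L'] where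
  toLin : L →ₗ[K] L'
  map_gr : ∀ (i : ZMod 2) (x : L), x ∈ gr (K := K) i → toLin x ∈ gr (K := K) i
  map_bracket : ∀ x y : L, toLin (bracket (K := K) x y) = bracket (K := K) (toLin x) (toLin y)

end Basic

/-! ### The free Lie superalgebra on a graded set

`X` is a set with a parity function `p : X → ℤ/2`. The free Lie superalgebra is the free
non-associative algebra, with basis the free magma on `X`, modulo the two-sided ideal generated by
super skew-symmetry and the super Jacobi identity. -/

section Free

variable (K : Type*) [Field K] {X : Type*} (p : X → ZMod 2)

/-- The parity of a non-associative word: the sum of the parities of its letters. -/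
def parity : FreeMagma X → ZMod 2
  | .of x => p x
  | .mul a b => parity a + parity b

theorem parity_mul (a b : FreeMagma X) : parity p (a * b) = parity p a + parity p b := rfl

/-- The product of the free non-associative algebra, extending the product of words. -/
noncomputable def wordMul : (FreeMagma X →₀ K) →ₗ[K] (FreeMagma X →₀ K) →ₗ[K] (FreeMagma X →₀ K) :=
  Finsupp.linearCombination K fun a => Finsupp.lmapDomain K K fun b => a * b

/-- A word, as an element of the free non-associative algebra. -/
noncomputable def word (a : FreeMagma X) : FreeMagma X →₀ K := Finsupp.single a 1

theorem wordMul_word (a b : FreeMagma X) :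
    wordMul K (word K a) (word K b) = word K (a * b) := by
  simp [wordMul, word]

/-- The relators, closed under multiplication by words on either side. -/
inductive Relator : (FreeMagma X →₀ K) → Prop
  | skew (a b : FreeMagma X) :
      Relator (word K (a * b) + superSign K (parity p a) (parity p b) • word K (b * a))
  | jacobi (a b c : FreeMagma X) :
      Relator (word K (a * (b * c)) - word K (a * b * c)
        - superSign K (parity p a) (parity p b) • word K (b * (a * c)))
  | mulLeft (a : FreeMagma X) (r : FreeMagma X →₀ K) :
      Relator r → Relator (wordMul K (word K a) r)
  | mulRight (a : FreeMagma X) (r : FreeMagma X →₀ K) :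
      Relator r → Relator (wordMul K r (word K a))

/-- The two-sided ideal of relations. -/
noncomputable def relIdeal : Submodule K (FreeMagma X →₀ K) := Submodule.span K {r | Relator K p r}

/-- The free Lie superalgebra over `K` on the set `X` graded by `p`. -/
abbrev FreeSuper : Type _ := (FreeMagma X →₀ K) ⧸ relIdeal K p

/-- The homogeneous components of the free non-associative algebra. -/
noncomputable def wordGr (i : ZMod 2) : Submodule K (FreeMagma X →₀ K) :=
  Submodule.span K (word K '' {a | parity p a = i})

theorem span_word : Submodule.span K (Set.range (word K (X := X))) = ⊤ := by
  rw [eq_top_iff]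
  intro f _
  induction f using Finsupp.induction_linear with
  | zero => exact zero_mem _
  | add f g hf hg => exact add_mem (hf trivial) (hg trivial)
  | single a c =>
    have : (Finsupp.single a c : FreeMagma X →₀ K) = c • word K a := by simp [word]
    rw [this]
    exact Submodule.smul_mem _ _ (Submodule.subset_span ⟨a, rfl⟩)

theorem word_mem (a : FreeMagma X) : word K a ∈ wordGr K p (parity p a) :=
  Submodule.subset_span ⟨a, rfl, rfl⟩

theorem wordMul_mem {i j : ZMod 2} {f g : FreeMagma X →₀ K} (hf : f ∈ wordGr K p i)
    (hg : g ∈ wordGr K p j) : wordMul K f g ∈ wordGr K p (i + j) := by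
  have h : Submodule.map₂ (wordMul K) (wordGr K p i) (wordGr K p j) ≤ wordGr K p (i + j) := by
    unfold wordGr
    rw [Submodule.map₂_span_span, Submodule.span_le]
    rintro _ ⟨_, ⟨a, rfl, rfl⟩, _, ⟨b, rfl, rfl⟩, rfl⟩
    change wordMul K (word K a) (word K b) ∈ wordGr K p (parity p (a * b))
    rw [wordMul_word]
    exact word_mem K p (a * b)
  exact h (Submodule.apply_mem_map₂ _ hf hg)

theorem relator_homogeneous {r : FreeMagma X →₀ K} (h : Relator K p r) :
    ∃ i, r ∈ wordGr K p i := by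
  induction h with
  | skew a b =>
    refine ⟨parity p a + parity p b, add_mem (word_mem K p (a * b)) (Submodule.smul_mem _ _ ?_)⟩
    rw [add_comm]
    exact word_mem K p (b * a)
  | jacobi a b c =>
    refine ⟨parity p a + (parity p b + parity p c),
      sub_mem (sub_mem (word_mem K p (a * (b * c))) ?_) (Submodule.smul_mem _ _ ?_)⟩
    · rw [← add_assoc]
      exact word_mem K p (a * b * c)
    · rw [add_left_comm]
      exact word_mem K p (b * (a * c))
  | mulLeft a r _ ih =>
    obtain ⟨i, hi⟩ := ih
    exact ⟨_, wordMul_mem K p (word_mem K p a) hi⟩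
  | mulRight a r _ ih =>
    obtain ⟨i, hi⟩ := ih
    exact ⟨_, wordMul_mem K p hi (word_mem K p a)⟩

/-- The projection of the free non-associative algebra to its component of parity `i`. -/
noncomputable def wordProj (i : ZMod 2) : (FreeMagma X →₀ K) →ₗ[K] (FreeMagma X →₀ K) :=
  Finsupp.linearCombination K fun a => if parity p a = i then word K a else 0

theorem wordProj_of_mem {i j : ZMod 2} {f : FreeMagma X →₀ K} (hf : f ∈ wordGr K p j) :
    wordProj K p i f = if j = i then f else 0 := by
  unfold wordGr at hf
  induction hf using Submodule.span_induction with
  | mem x hx =>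
    obtain ⟨a, rfl, rfl⟩ := hx
    simp [wordProj, word]
  | zero => simp
  | add x y _ _ hx hy =>
    rw [map_add, hx, hy]
    split_ifs <;> simp
  | smul c x _ hx =>
    rw [map_smul, hx]
    split_ifs <;> simp

theorem wordProj_relIdeal (i : ZMod 2) {f : FreeMagma X →₀ K} (hf : f ∈ relIdeal K p) :
    wordProj K p i f ∈ relIdeal K p := by
  have h : relIdeal K p ≤ (relIdeal K p).comap (wordProj K p i) := by
    conv_lhs => unfold relIdeal
    rw [Submodule.span_le]
    intro r hr
    obtain ⟨j, hj⟩ := relator_homogeneous K p hr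
    change wordProj K p i r ∈ relIdeal K p
    rw [wordProj_of_mem K p hj]
    split_ifs
    · exact Submodule.subset_span hr
    · exact zero_mem _
  exact h hf

theorem wordMul_mem_left (f : FreeMagma X →₀ K) {r : FreeMagma X →₀ K} (hr : r ∈ relIdeal K p) :
    wordMul K f r ∈ relIdeal K p := by
  have h : Submodule.map₂ (wordMul K) ⊤ (relIdeal K p) ≤ relIdeal K p := by
    conv_lhs => unfold relIdeal
    rw [← span_word, Submodule.map₂_span_span, Submodule.span_le]
    rintro _ ⟨_, ⟨a, rfl⟩, r, hr, rfl⟩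
    exact Submodule.subset_span (.mulLeft a r hr)
  exact h (Submodule.apply_mem_map₂ _ trivial hr)

theorem wordMul_mem_right {r : FreeMagma X →₀ K} (hr : r ∈ relIdeal K p) (f : FreeMagma X →₀ K) :
    wordMul K r f ∈ relIdeal K p := by
  have h : Submodule.map₂ (wordMul K) (relIdeal K p) ⊤ ≤ relIdeal K p := by
    conv_lhs => unfold relIdeal
    rw [← span_word, Submodule.map₂_span_span, Submodule.span_le]
    rintro _ ⟨r, hr, _, ⟨a, rfl⟩, rfl⟩
    exact Submodule.subset_span (.mulRight a r hr)
  exact h (Submodule.apply_mem_map₂ _ hr trivial)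

/-- The bracket of the free Lie superalgebra, induced by the product of words. -/
noncomputable def freeBracket : FreeSuper K p →ₗ[K] FreeSuper K p →ₗ[K] FreeSuper K p :=
  (relIdeal K p).liftQ
    { toFun := fun f => (relIdeal K p).mapQ (relIdeal K p) (wordMul K f)
        fun _ hr => wordMul_mem_left K p f hr
      map_add' := fun f g => by ext; simp
      map_smul' := fun c f => by ext; simp }
    (fun r hr => by
      rw [LinearMap.mem_ker]
      refine LinearMap.ext fun x => ?_
      obtain ⟨f, rfl⟩ := Submodule.mkQ_surjective _ x
      simpa using wordMul_mem_right K p hr f)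

theorem freeBracket_mk (f g : FreeMagma X →₀ K) :
    freeBracket K p ((relIdeal K p).mkQ f) ((relIdeal K p).mkQ g) =
      (relIdeal K p).mkQ (wordMul K f g) := rfl

theorem mk_skew {i j : ZMod 2} {f g : FreeMagma X →₀ K} (hf : f ∈ wordGr K p i)
    (hg : g ∈ wordGr K p j) :
    wordMul K f g + superSign K i j • wordMul K g f ∈ relIdeal K p := by
  have h : Submodule.map₂ (wordMul K + superSign K i j • (wordMul K).flip) (wordGr K p i)
      (wordGr K p j) ≤ relIdeal K p := by
    unfold wordGr
    rw [Submodule.map₂_span_span, Submodule.span_le]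
    rintro _ ⟨_, ⟨a, rfl, rfl⟩, _, ⟨b, rfl, rfl⟩, rfl⟩
    simp only [LinearMap.add_apply, LinearMap.smul_apply, LinearMap.flip_apply, wordMul_word]
    exact Submodule.subset_span (.skew a b)
  exact h (Submodule.apply_mem_map₂ _ hf hg)

theorem mk_jacobi {i j k : ZMod 2} {f g h : FreeMagma X →₀ K} (hf : f ∈ wordGr K p i)
    (hg : g ∈ wordGr K p j) (hh : h ∈ wordGr K p k) :
    wordMul K f (wordMul K g h) - wordMul K (wordMul K f g) h
      - superSign K i j • wordMul K g (wordMul K f h) ∈ relIdeal K p := by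
  unfold wordGr at hf hg hh
  induction hf using Submodule.span_induction with
  | zero => simp
  | add x y _ _ hx hy =>
    convert add_mem hx hy using 1
    simp only [map_add, LinearMap.add_apply, smul_add]
    abel
  | smul c x _ hx =>
    convert Submodule.smul_mem _ c hx using 1
    simp only [map_smul, LinearMap.smul_apply, smul_sub, smul_comm c]
  | mem x hx =>
  obtain ⟨a, rfl, rfl⟩ := hx
  induction hg using Submodule.span_induction with
  | zero => simp
  | add x y _ _ hx hy =>
    convert add_mem hx hy using 1
    simp only [map_add, LinearMap.add_apply, smul_add]
    abel
  | smul c x _ hx =>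
    convert Submodule.smul_mem _ c hx using 1
    simp only [map_smul, LinearMap.smul_apply, smul_sub, smul_comm c]
  | mem x hx =>
  obtain ⟨b, rfl, rfl⟩ := hx
  induction hh using Submodule.span_induction with
  | zero => simp
  | add x y _ _ hx hy =>
    convert add_mem hx hy using 1
    simp only [map_add, smul_add]
    abel
  | smul c x _ hx =>
    convert Submodule.smul_mem _ c hx using 1
    simp only [map_smul, smul_sub, smul_comm c]
  | mem x hx =>
  obtain ⟨c, rfl, rfl⟩ := hx
  simp only [wordMul_word]
  exact Submodule.subset_span (.jacobi a b c)

noncomputable instance instFreeSuper : LieSuperalgebra K (FreeSuper K p) where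
  gr i := (wordGr K p i).map (relIdeal K p).mkQ
  isCompl_gr := by
    constructor
    · rw [Submodule.disjoint_def]
      rintro _ ⟨f, hf, rfl⟩ ⟨g, hg, hfg⟩
      have h1 : f - g ∈ relIdeal K p := by
        rw [← Submodule.Quotient.eq]; exact hfg.symm
      have h2 := wordProj_relIdeal K p 0 h1
      rw [map_sub, wordProj_of_mem K p hf, wordProj_of_mem K p hg] at h2
      simpa using h2
    · rw [codisjoint_iff, ← Submodule.map_sup, ← Submodule.range_mkQ, LinearMap.range_eq_map]
      congr 1
      rw [eq_top_iff, ← span_word, Submodule.span_le]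
      rintro _ ⟨a, rfl⟩
      have h := word_mem K p a
      generalize parity p a = i at h
      fin_cases i
      · exact Submodule.mem_sup_left h
      · exact Submodule.mem_sup_right h
  bracket := freeBracket K p
  bracket_mem := by
    rintro i j _ _ ⟨f, hf, rfl⟩ ⟨g, hg, rfl⟩
    exact ⟨_, wordMul_mem K p hf hg, rfl⟩
  skew := by
    rintro i j _ _ ⟨f, hf, rfl⟩ ⟨g, hg, rfl⟩
    rw [eq_neg_iff_add_eq_zero, freeBracket_mk, freeBracket_mk, ← map_smul, ← map_add]
    exact (Submodule.Quotient.mk_eq_zero _).2 (mk_skew K p hf hg)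
  jacobi := by
    rintro i j k _ _ _ ⟨f, hf, rfl⟩ ⟨g, hg, rfl⟩ ⟨h, hh, rfl⟩
    rw [← sub_eq_zero, ← sub_sub]
    simp only [freeBracket_mk]
    rw [← map_smul, ← map_sub, ← map_sub]
    exact (Submodule.Quotient.mk_eq_zero _).2 (mk_jacobi K p hf hg hh)

/-- The generator of the free Lie superalgebra given by `x`. -/
noncomputable def FreeSuper.of (x : X) : FreeSuper K p := (relIdeal K p).mkQ (word K (.of x))

theorem FreeSuper.of_mem (x : X) : FreeSuper.of K p x ∈ gr (K := K) (L := FreeSuper K p) (p x) :=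
  ⟨_, word_mem K p (.of x), rfl⟩

end Free

section Lift

variable {K : Type*} [Field K] {X : Type*} {p : X → ZMod 2}
  {L : Type*} [AddCommGroup L] [Module K L] [LieSuperalgebra K L]

variable (K) in
/-- Evaluation of a non-associative word in a Lie superalgebra. -/
def evalWord (φ : X → L) : FreeMagma X → L
  | .of x => φ x
  | .mul a b => bracket (K := K) (evalWord φ a) (evalWord φ b)

theorem evalWord_mul (φ : X → L) (a b : FreeMagma X) :
    evalWord K φ (a * b) = bracket (K := K) (evalWord K φ a) (evalWord K φ b) := rfl

theorem evalWord_mem {φ : X → L} (hφ : ∀ x, φ x ∈ gr (K := K) (p x)) (a : FreeMagma X) :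
    evalWord K φ a ∈ gr (K := K) (L := L) (parity p a) := by
  induction a using FreeMagma.recOnMul with
  | ih1 x => exact hφ x
  | ih2 a b iha ihb => exact bracket_mem iha ihb

variable (K) in
/-- The linear extension of `evalWord`. -/
noncomputable def evalLin (φ : X → L) : (FreeMagma X →₀ K) →ₗ[K] L :=
  Finsupp.linearCombination K (evalWord K φ)

theorem evalLin_word (φ : X → L) (a : FreeMagma X) : evalLin K φ (word K a) = evalWord K φ a := by
  simp [evalLin, word]

theorem evalLin_mul (φ : X → L) (f g : FreeMagma X →₀ K) :
    evalLin K φ (wordMul K f g) = bracket (K := K) (evalLin K φ f) (evalLin K φ g) := by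
  have h : (wordMul K).compr₂ (evalLin K φ) =
      (bracket (K := K) (L := L)).compl₁₂ (evalLin K φ) (evalLin K φ) := by
    refine Finsupp.lhom_ext' fun a => LinearMap.ext_ring <| Finsupp.lhom_ext' fun b =>
      LinearMap.ext_ring ?_
    change evalLin K φ (wordMul K (word K a) (word K b)) =
      bracket (K := K) (evalLin K φ (word K a)) (evalLin K φ (word K b))
    rw [wordMul_word, evalLin_word, evalLin_word, evalLin_word, evalWord_mul]
  exact LinearMap.congr_fun₂ h f g

theorem evalLin_relator {φ : X → L} (hφ : ∀ x, φ x ∈ gr (K := K) (p x)) {r : FreeMagma X →₀ K}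
    (hr : Relator K p r) : evalLin K φ r = 0 := by
  induction hr with
  | skew a b =>
    simp only [map_add, map_smul, evalLin_word, evalWord_mul]
    rw [skew (evalWord_mem hφ a) (evalWord_mem hφ b), neg_add_cancel]
  | jacobi a b c =>
    simp only [map_sub, map_smul, evalLin_word, evalWord_mul]
    rw [jacobi (evalWord_mem hφ a) (evalWord_mem hφ b) (evalWord_mem hφ c), add_sub_cancel_left,
      sub_self]
  | mulLeft a r _ ih => rw [evalLin_mul, ih, map_zero]
  | mulRight a r _ ih => rw [evalLin_mul, ih, map_zero, LinearMap.zero_apply]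

/-- The universal property of the free Lie superalgebra: a parity-preserving map from the graded
set `X` to a Lie superalgebra extends to a homomorphism. -/
noncomputable def FreeSuper.lift (φ : X → L) (hφ : ∀ x, φ x ∈ gr (K := K) (p x)) :
    Hom K (FreeSuper K p) L where
  toLin := (relIdeal K p).liftQ (evalLin K φ) <| by
    unfold relIdeal
    rw [Submodule.span_le]
    exact fun r hr => evalLin_relator hφ hr
  map_gr := by
    rintro i _ ⟨f, hf, rfl⟩
    have h : wordGr K p i ≤ (gr (K := K) (L := L) i).comap (evalLin K φ) := by
      unfold wordGr
      rw [Submodule.span_le]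
      rintro _ ⟨a, rfl, rfl⟩
      change evalLin K φ (word K a) ∈ gr (K := K) (L := L) (parity p a)
      rw [evalLin_word]
      exact evalWord_mem hφ a
    exact h hf
  map_bracket := by
    intro x y
    obtain ⟨f, rfl⟩ := Submodule.mkQ_surjective _ x
    obtain ⟨g, rfl⟩ := Submodule.mkQ_surjective _ y
    exact evalLin_mul φ f g

theorem FreeSuper.lift_of (φ : X → L) (hφ : ∀ x, φ x ∈ gr (K := K) (p x)) (x : X) :
    (FreeSuper.lift φ hφ).toLin (FreeSuper.of K p x) = φ x :=
  evalLin_word φ (.of x)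

end Lift

/-! ### The Schur multiplier -/

section Multiplier

universe u v w

variable (K : Type u) (L : Type v) [Field K] [AddCommGroup L] [Module K L] [LieSuperalgebra K L]

/-- A free presentation `L ≅ F / R`: a surjective homomorphism `π : F → L` from the free Lie
superalgebra `F` on some graded set; `R` is the kernel of `π`. -/
structure FreePresentation where
  X : Type w
  par : X → ZMod 2
  π : Hom K (FreeSuper K par) L
  surj : Function.Surjective π.toLin

/-- Every Lie superalgebra has a free presentation: take all homogeneous elements as generators. -/
noncomputable def FreePresentation.canonical : FreePresentation.{u, v, v} K L where
  X := Σ i : ZMod 2, ↥(gr (K := K) (L := L) i)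
  par := Sigma.fst
  π := FreeSuper.lift (X := Σ i : ZMod 2, ↥(gr (K := K) (L := L) i)) (p := Sigma.fst)
    (fun x => (x.2 : L)) fun x => x.2.2
  surj := by
    intro x
    obtain ⟨y, hy, z, hz, rfl⟩ := Submodule.mem_sup.1
      (show x ∈ gr (K := K) (L := L) 0 ⊔ gr (K := K) (L := L) 1 by
        rw [isCompl_gr.sup_eq_top]; trivial)
    refine ⟨FreeSuper.of K _ ⟨0, y, hy⟩ + FreeSuper.of K _ ⟨1, z, hz⟩, ?_⟩
    rw [map_add, FreeSuper.lift_of, FreeSuper.lift_of]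

namespace FreePresentation

variable {K L} (P : FreePresentation.{u, v, w} K L)

/-- The free Lie superalgebra `F` of the presentation. -/
abbrev F : Type _ := FreeSuper K P.par

/-- The ideal of relations `R`. -/
noncomputable def R : Submodule K P.F := LinearMap.ker P.π.toLin

theorem bracketSpan_R_le : bracketSpan K P.R ⊤ ≤ P.R ⊓ derived K P.F := by
  refine Submodule.map₂_le.2 fun r hr f _ => ⟨?_, Submodule.apply_mem_map₂ _ trivial trivial⟩
  have hr' : P.π.toLin r = 0 := hr
  change P.π.toLin _ = 0
  rw [P.π.map_bracket, hr', map_zero, LinearMap.zero_apply]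

/-- The Schur multiplier `M(L) = (R ∩ F²) / [R, F]`, computed from the free presentation
`L ≅ F / R` (it does not depend on the presentation, up to isomorphism; `[R, F] ⊆ R ∩ F²`). -/
abbrev SchurMultiplier : Type _ :=
  ↥(P.R ⊓ derived K P.F) ⧸ (bracketSpan K P.R ⊤).submoduleOf (P.R ⊓ derived K P.F)

end FreePresentation

end Multiplier

end LieSuperalgebra

/-! Write `d = m + n`. The bracket of `F` modulo `[R, F]` depends only on images in `L`, so it is a
cocycle `β` on `L` with values in `F/[R, F]`. Its values span `V = F²/[R, F]`, which maps onto `L²`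
with kernel `M(L)`. Since `dim L² = d - 2`, the claim `dim M(L) ≤ m + 2n - 4` is equivalent to `dim
V + 6 ≤ 2d + n`.

As `L/L²` is two-dimensional, `L` is generated modulo `L²` by two homogeneous elements `x, y`.
Nilpotency and the Jacobi identity allow the first argument of `β` to be restricted to their span
(`IsSuperCocycle.map₂_top_top_le`). Hence `V` lies in the image of `L × L` under `(u, v) ↦ β(x, u) +
β(y, v)`, and `dim V ≤ 2d - k` whenever this map kills `k` independent pairs
(`finrank_map₂_add_le`). It remains to find `k` with `k + n ≥ 6`.

Such pairs come from skew-symmetry and from the Jacobi identity on an odd square: `β(y, [y, y]) = 0`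
and `β(x, [y, y]) = ±2 β(y, [x, y])` for odd `y`; this is where characteristics 3 and 2 are
excluded. Either four independent pairs arise and `n ≥ 2`, or three arise and `n ≥ 3`. The bounds on
`n` hold because a smaller odd part would confine `L` to the span of at most three elements, against
`d ≥ 4` (`finrank_le_of_stable_span`). Two even generators are impossible, since then `L` would have
no odd part. -/

namespace LieSuperalgebra

section Signs

variable (K : Type*) [Field K]

theorem superSign_zero_left (j : ZMod 2) : superSign K 0 j = 1 := by
  simp [superSign]

theorem superSign_zero_right (i : ZMod 2) : superSign K i 0 = 1 := by
  simp [superSign]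

theorem superSign_one_one : superSign K 1 1 = -1 := by
  simp [superSign, ZMod.val_one]

end Signs

/-! ### Cocycles and generation in nilpotent Lie superalgebras -/

section Cocycle

variable {K L Q : Type*} [Field K] [AddCommGroup L] [Module K L] [LieSuperalgebra K L]
  [AddCommGroup Q] [Module K Q]

/-- A `Q`-valued `2`-cocycle of a Lie superalgebra, with `Q` a trivial module. -/
structure IsSuperCocycle (β : L →ₗ[K] L →ₗ[K] Q) : Prop where
  skew : ∀ {i j : ZMod 2} {x y : L}, x ∈ gr (K := K) i → y ∈ gr (K := K) j →
    β x y = -(superSign K i j • β y x)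
  jacobi : ∀ {i j k : ZMod 2} {x y z : L}, x ∈ gr (K := K) i → y ∈ gr (K := K) j →
    z ∈ gr (K := K) k →
    β x (bracket (K := K) y z) =
      β (bracket (K := K) x y) z + superSign K i j • β y (bracket (K := K) x z)

theorem isSuperCocycle_bracket : IsSuperCocycle (bracket (K := K) (L := L)) where
  skew := skew
  jacobi := jacobi

variable (K) in
theorem exists_homogeneous_add (x : L) :
    ∃ y ∈ gr (K := K) (L := L) 0, ∃ z ∈ gr (K := K) (L := L) 1, y + z = x :=
  Submodule.mem_sup.1 (by rw [isCompl_gr.sup_eq_top]; trivial)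

variable (K L) in
theorem span_homogeneous :
    Submodule.span K {x : L | ∃ i, x ∈ gr (K := K) (L := L) i} = ⊤ := by
  refine eq_top_iff.2 fun x _ => ?_
  obtain ⟨y, hy, z, hz, rfl⟩ := exists_homogeneous_add K x
  exact add_mem (Submodule.subset_span ⟨0, hy⟩) (Submodule.subset_span ⟨1, hz⟩)

theorem bracketSpan_le_of_homogeneous {A : Submodule K L}
    (h : ∀ {i j : ZMod 2} {x y : L}, x ∈ gr (K := K) i → y ∈ gr (K := K) j →
      bracket (K := K) x y ∈ A) : derived K L ≤ A := by
  unfold derived bracketSpan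
  rw [← span_homogeneous K L, Submodule.map₂_span_span, Submodule.span_le]
  rintro _ ⟨x, ⟨i, hx⟩, y, ⟨j, hy⟩, rfl⟩
  exact h hx hy

theorem bracket_mem_derived (x y : L) : bracket (K := K) x y ∈ derived K L :=
  Submodule.apply_mem_map₂ _ trivial trivial

namespace IsSuperCocycle

variable {β : L →ₗ[K] L →ₗ[K] Q} (hβ : IsSuperCocycle β)
include hβ

theorem jacobi_right {i j : ZMod 2} {x y : L} (hx : x ∈ gr (K := K) i) (hy : y ∈ gr (K := K) j)
    (z : L) : β x (bracket (K := K) y z) =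
      β (bracket (K := K) x y) z + superSign K i j • β y (bracket (K := K) x z) := by
  obtain ⟨u, hu, v, hv, rfl⟩ := exists_homogeneous_add K z
  simp only [map_add, smul_add, hβ.jacobi hx hy hu, hβ.jacobi hx hy hv]
  abel

/-- The Jacobi identity writes `β([a, b], w)` as `β(a, [b, w]) ∓ β(b, [a, w])`: a commutator in the
first slot is traded for one step down the lower central series in the second. -/
theorem map₂_top_lowerCentral_le {S : Submodule K L} (hS : S ⊔ derived K L = ⊤) (k : ℕ) :
    Submodule.map₂ β ⊤ (lowerCentral K L k) ≤
      Submodule.map₂ β S ⊤ ⊔ Submodule.map₂ β ⊤ (lowerCentral K L (k + 1)) := by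
  conv_lhs => rw [← hS, Submodule.map₂_sup_left]
  refine sup_le (le_sup_of_le_left (Submodule.map₂_le_map₂_right le_top))
    (le_sup_of_le_right (Submodule.map₂_le.2 fun x hx w hw => ?_))
  let A : Submodule K L :=
    (Submodule.map₂ β ⊤ (lowerCentral K L (k + 1))).comap (β.flip w)
  refine (bracketSpan_le_of_homogeneous (A := A) fun {i j a b} ha hb => ?_) hx
  have h : ∀ c : L, bracket (K := K) c w ∈ lowerCentral K L (k + 1) := fun c =>
    Submodule.apply_mem_map₂ _ trivial hw
  change β _ w ∈ Submodule.map₂ β ⊤ (lowerCentral K L (k + 1))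
  rw [eq_sub_of_add_eq (hβ.jacobi_right ha hb w).symm]
  exact sub_mem (Submodule.apply_mem_map₂ _ trivial (h b))
    (Submodule.smul_mem _ _ (Submodule.apply_mem_map₂ _ trivial (h a)))

/-- In a nilpotent Lie superalgebra, a cocycle is determined by its values on generators in the
first variable. -/
theorem map₂_top_top_le (hnil : IsNilpotent K L) {S : Submodule K L}
    (hS : S ⊔ derived K L = ⊤) : Submodule.map₂ β ⊤ ⊤ ≤ Submodule.map₂ β S ⊤ := by
  have h : ∀ k, Submodule.map₂ β ⊤ ⊤ ≤
      Submodule.map₂ β S ⊤ ⊔ Submodule.map₂ β ⊤ (lowerCentral K L k) := by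
    intro k
    induction k with
    | zero => exact le_sup_right
    | succ k ih =>
      exact ih.trans (sup_le le_sup_left (hβ.map₂_top_lowerCentral_le hS k))
  obtain ⟨c, hc⟩ := hnil
  simpa [hc] using h c

end IsSuperCocycle

/-- A subspace stable under bracketing with generators of a nilpotent Lie superalgebra that
contains these generators is everything. -/
theorem eq_top_of_stable (hnil : IsNilpotent K L) {S W : Submodule K L}
    (hS : S ⊔ derived K L = ⊤) (hSW : S ≤ W) (hW : bracketSpan K S W ≤ W) : W = ⊤ := by
  -- The bracket is itself a cocycle, so the previous result gives `L² = [S, L]`.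
  have hgen : derived K L ≤ bracketSpan K S ⊤ :=
    (isSuperCocycle_bracket (K := K) (L := L)).map₂_top_top_le hnil hS
  have h : ∀ k, ⊤ ≤ W ⊔ lowerCentral K L k := by
    intro k
    induction k with
    | zero => exact le_sup_right
    | succ k ih =>
      rw [← hS]
      refine sup_le (hSW.trans le_sup_left) (hgen.trans ?_)
      refine (Submodule.map₂_le_map₂_right ih).trans ?_
      rw [Submodule.map₂_sup_right]
      exact sup_le_sup hW (Submodule.map₂_le_map₂_left le_top)
  obtain ⟨c, hc⟩ := hnil
  simpa [hc] using h c

theorem eq_top_of_stable_pair (hnil : IsNilpotent K L) {x y : L} {W : Submodule K L}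
    (hS : Submodule.span K {x, y} ⊔ derived K L = ⊤) (hx : x ∈ W) (hy : y ∈ W)
    (hxW : ∀ w ∈ W, bracket (K := K) x w ∈ W) (hyW : ∀ w ∈ W, bracket (K := K) y w ∈ W) :
    W = ⊤ := by
  have hSW : Submodule.span K {x, y} ≤ W := by
    rw [Submodule.span_le]
    rintro _ (rfl | rfl) <;> assumption
  refine eq_top_of_stable hnil hS hSW (Submodule.map₂_le.2 fun s hs w hw => ?_)
  obtain ⟨a, b, rfl⟩ := Submodule.mem_span_pair.1 hs
  simp only [map_add, map_smul, LinearMap.add_apply, LinearMap.smul_apply]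
  exact add_mem (W.smul_mem _ (hxW w hw)) (W.smul_mem _ (hyW w hw))

/-- A spanning-set version of `eq_top_of_stable_pair`, concluding with a dimension bound. -/
theorem finrank_le_of_stable_span (hnil : IsNilpotent K L) {x y : L} (s : Finset L)
    (hS : Submodule.span K {x, y} ⊔ derived K L = ⊤) (hx : x ∈ Submodule.span K (s : Set L))
    (hy : y ∈ Submodule.span K (s : Set L))
    (hxs : ∀ w ∈ s, bracket (K := K) x w ∈ Submodule.span K (s : Set L))
    (hys : ∀ w ∈ s, bracket (K := K) y w ∈ Submodule.span K (s : Set L)) :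
    Module.finrank K L ≤ s.card := by
  have key : ∀ z : L, (∀ w ∈ s, bracket (K := K) z w ∈ Submodule.span K (s : Set L)) →
      ∀ w ∈ Submodule.span K (s : Set L), bracket (K := K) z w ∈ Submodule.span K (s : Set L) := by
    intro z hz
    have : Submodule.span K (s : Set L) ≤
        (Submodule.span K (s : Set L)).comap (bracket (K := K) z) :=
      Submodule.span_le.2 hz
    exact this
  have h := eq_top_of_stable_pair hnil hS hx hy (key x hxs) (key y hys)
  rw [← finrank_top K L, ← h]
  exact finrank_span_finset_le_card s

end Cocycle

/-! ### Homogeneous generators -/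

section Generators

variable {K L : Type*} [Field K] [AddCommGroup L] [Module K L] [LieSuperalgebra K L]

theorem finrank_of_hasSuperdim {m n : ℕ} (hdim : HasSuperdim K L m n) :
    Module.finrank K L = m + n := by
  obtain ⟨hfin, h0, h1⟩ := hdim
  rw [← h0, ← h1, Submodule.finrank_add_eq_of_isCompl isCompl_gr]

/-- Homogeneous generators of a Lie superalgebra with two-dimensional abelianization. -/
theorem exists_homogeneous_generators [Module.Finite K L]
    (h : Module.finrank K (L ⧸ derived K L) = 2) :
    ∃ (i j : ZMod 2) (x y : L), x ∈ gr (K := K) i ∧ y ∈ gr (K := K) j ∧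
      Submodule.span K {x, y} ⊔ derived K L = ⊤ ∧
      ∀ a b : K, a • x + b • y ∈ derived K L → a = 0 ∧ b = 0 := by
  set D := derived K L
  -- Homogeneous elements span `L`, so their classes span `L/L²` and a basis can be chosen among
  -- these classes.
  have hs : ⊤ ≤ Submodule.span K (D.mkQ '' {x : L | ∃ i, x ∈ gr (K := K) (L := L) i}) := by
    rw [Submodule.span_image, span_homogeneous, Submodule.map_top, Submodule.range_mkQ]
  let B := Module.Basis.ofSpan hs
  have hB : ∀ t, ∃ x : L, (∃ i, x ∈ gr (K := K) (L := L) i) ∧ D.mkQ x = B t := fun t =>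
    Module.Basis.ofSpan_subset hs ⟨t, rfl⟩
  let : Fintype ((linearIndepOn_empty K id).extend
    (Set.empty_subset (D.mkQ '' {x : L | ∃ i, x ∈ gr (K := K) (L := L) i}))) :=
    FiniteDimensional.fintypeBasisIndex B
  have hc := Module.finrank_eq_card_basis B
  rw [h] at hc
  let C := B.reindex (Fintype.equivFinOfCardEq hc.symm)
  have hC : ∀ t, ∃ x : L, (∃ i, x ∈ gr (K := K) (L := L) i) ∧ D.mkQ x = C t := fun t => by
    simpa [C] using hB _
  obtain ⟨x, ⟨i, hx⟩, hxC⟩ := hC 0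
  obtain ⟨y, ⟨j, hy⟩, hyC⟩ := hC 1
  refine ⟨i, j, x, y, hx, hy, eq_top_iff.2 fun z _ => ?_, fun a b hab => ?_⟩
  · have hz := C.sum_repr (D.mkQ z)
    rw [Fin.sum_univ_two, ← hxC, ← hyC, ← map_smul, ← map_smul, ← map_add, eq_comm,
      ← sub_eq_zero, ← map_sub, Submodule.mkQ_apply, Submodule.Quotient.mk_eq_zero] at hz
    exact Submodule.mem_sup.2 ⟨_, Submodule.mem_span_pair.2 ⟨_, _, rfl⟩, _, hz, add_sub_cancel _ _⟩
  · have h0 : a • C 0 + b • C 1 = 0 := by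
      rw [← hxC, ← hyC, ← map_smul, ← map_smul, ← map_add, Submodule.mkQ_apply,
        Submodule.Quotient.mk_eq_zero]
      exact hab
    have := Fintype.linearIndependent_iff.1 C.linearIndependent ![a, b] (by simpa using h0)
    exact ⟨this 0, this 1⟩

end Generators

/-! ### The cocycle of a presentation -/

section Extension

variable {K E L : Type*} [Field K] [AddCommGroup L] [Module K L] [LieSuperalgebra K L]
  [AddCommGroup E] [Module K E] [LieSuperalgebra K E]

theorem Hom.exists_homogeneous_lift (π : Hom K E L) (hπ : Function.Surjective π.toLin)
    {i : ZMod 2} {x : L} (hx : x ∈ gr (K := K) i) :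
    ∃ a ∈ gr (K := K) (L := E) i, π.toLin a = x := by
  obtain ⟨f, rfl⟩ := hπ x
  obtain ⟨u, hu, v, hv, rfl⟩ := exists_homogeneous_add K f
  have hu' := π.map_gr 0 u hu
  have hv' := π.map_gr 1 v hv
  have hd := Submodule.disjoint_def.1 (isCompl_gr (K := K) (L := L)).disjoint
  rw [map_add] at hx ⊢
  have hi : i = 0 ∨ i = 1 := by clear hx; revert i; decide
  rcases hi with rfl | rfl
  · refine ⟨u, hu, ?_⟩
    rw [hd _ ((Submodule.add_mem_iff_right _ hu').1 hx) hv', add_zero]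
  · refine ⟨v, hv, ?_⟩
    rw [hd _ hu' ((Submodule.add_mem_iff_left _ hv').1 hx), zero_add]

/-- For an epimorphism `π : E → L` with kernel `R`, the bracket of `E` modulo `[R, E]` is a
cocycle of `L`. -/
theorem Hom.exists_cocycle (π : Hom K E L) (hπ : Function.Surjective π.toLin) :
    ∃ β : L →ₗ[K] L →ₗ[K] E ⧸ bracketSpan K (LinearMap.ker π.toLin) ⊤,
      IsSuperCocycle β ∧ ∀ a b : E, β (π.toLin a) (π.toLin b) =
        (bracketSpan K (LinearMap.ker π.toLin) ⊤).mkQ (bracket (K := K) a b) := by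
  set R := LinearMap.ker π.toLin
  set I := bracketSpan K R ⊤
  have hleft : ∀ r ∈ R, ∀ a : E, bracket (K := K) r a ∈ I := fun r hr a =>
    Submodule.apply_mem_map₂ _ hr trivial
  -- `[E, R] ⊆ [R, E]` needs skew-symmetry, available only for homogeneous elements. As `π`
  -- preserves parity, the components of an element of `R` lie again in `R`.
  have hright : ∀ r ∈ R, ∀ a : E, bracket (K := K) a r ∈ I := by
    intro r hr a
    obtain ⟨u, hu, v, hv, rfl⟩ := exists_homogeneous_add K r
    have hu' := π.map_gr 0 u hu
    have hv' := π.map_gr 1 v hv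
    have hsum : π.toLin u + π.toLin v = 0 := by rw [← map_add]; exact hr
    have hd := Submodule.disjoint_def.1 (isCompl_gr (K := K) (L := L)).disjoint
    have huR : u ∈ R := hd _ hu' (by rw [eq_neg_of_add_eq_zero_left hsum]; exact neg_mem hv')
    have hvR : v ∈ R := by
      have : π.toLin u = 0 := huR
      rw [this, zero_add] at hsum
      exact hsum
    have key : ∀ {i j : ZMod 2} {s b : E}, s ∈ R → s ∈ gr (K := K) i → b ∈ gr (K := K) j →
        bracket (K := K) b s ∈ I := by
      intro i j s b hs hsi hb
      rw [skew hb hsi]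
      exact neg_mem (I.smul_mem _ (hleft s hs b))
    obtain ⟨b, hb, c, hc, rfl⟩ := exists_homogeneous_add K a
    simp only [map_add, LinearMap.add_apply]
    exact add_mem (add_mem (key huR hu hb) (key huR hu hc)) (add_mem (key hvR hv hb) (key hvR hv hc))
  obtain ⟨s, hs⟩ := π.toLin.exists_rightInverse_of_surjective (LinearMap.range_eq_top.2 hπ)
  have hs' : ∀ x, π.toLin (s x) = x := fun x => LinearMap.congr_fun hs x
  -- Any linear section serves: changing a lift by an element of `R` changes brackets only within
  -- `[R, E]`.
  let β : L →ₗ[K] L →ₗ[K] E ⧸ I := ((bracket (K := K) (L := E)).compr₂ I.mkQ).compl₁₂ s s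
  have hβ : ∀ a b : E, β (π.toLin a) (π.toLin b) = I.mkQ (bracket (K := K) a b) := by
    intro a b
    have ha : s (π.toLin a) - a ∈ R := by
      change π.toLin _ = 0
      rw [map_sub, hs', sub_self]
    have hb : s (π.toLin b) - b ∈ R := by
      change π.toLin _ = 0
      rw [map_sub, hs', sub_self]
    change I.mkQ (bracket (K := K) (s (π.toLin a)) (s (π.toLin b))) = _
    rw [← sub_eq_zero, ← map_sub, Submodule.mkQ_apply, Submodule.Quotient.mk_eq_zero]
    have h := add_mem (hleft _ ha (s (π.toLin b))) (hright _ hb a)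
    simpa only [map_sub, LinearMap.sub_apply, sub_add_sub_cancel] using h
  refine ⟨β, ⟨fun {i j x y} hx hy => ?_, fun {i j k x y z} hx hy hz => ?_⟩, hβ⟩
  · obtain ⟨a, ha, rfl⟩ := π.exists_homogeneous_lift hπ hx
    obtain ⟨b, hb, rfl⟩ := π.exists_homogeneous_lift hπ hy
    rw [hβ, hβ, skew ha hb, map_neg, map_smul]
  · obtain ⟨a, ha, rfl⟩ := π.exists_homogeneous_lift hπ hx
    obtain ⟨b, hb, rfl⟩ := π.exists_homogeneous_lift hπ hy
    obtain ⟨c, hc, rfl⟩ := π.exists_homogeneous_lift hπ hz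
    simp only [← π.map_bracket, hβ]
    rw [jacobi ha hb hc, map_add, map_smul]

end Extension

/-! ### Rank-nullity for pairs of generators -/

section Bound

variable {K L Q : Type*} [Field K] [AddCommGroup L] [Module K L] [AddCommGroup Q] [Module K Q]

/-- The values of a cocycle on a pair of elements in the first variable. -/
def pairMap (β : L →ₗ[K] L →ₗ[K] Q) (x y : L) : L × L →ₗ[K] Q := (β x).coprod (β y)

theorem pairMap_apply (β : L →ₗ[K] L →ₗ[K] Q) (x y u v : L) :
    pairMap β x y (u, v) = β x u + β y v := rfl

variable [LieSuperalgebra K L]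

theorem IsSuperCocycle.map₂_le_range_pairMap {β : L →ₗ[K] L →ₗ[K] Q} (hβ : IsSuperCocycle β)
    (hnil : IsNilpotent K L) {x y : L} (hS : Submodule.span K {x, y} ⊔ derived K L = ⊤) :
    Submodule.map₂ β ⊤ ⊤ ≤ LinearMap.range (pairMap β x y) := by
  refine (hβ.map₂_top_top_le hnil hS).trans (Submodule.map₂_le.2 fun s hs w _ => ?_)
  obtain ⟨a, b, rfl⟩ := Submodule.mem_span_pair.1 hs
  exact ⟨(a • w, b • w), by simp [pairMap_apply]⟩

/-- Rank-nullity for `pairMap`: each independent pair in its kernel lowers the trivial bound `2 dim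
L` by one. -/
theorem finrank_map₂_add_le [Module.Finite K L] {β : L →ₗ[K] L →ₗ[K] Q} (hβ : IsSuperCocycle β)
    (hnil : IsNilpotent K L) {x y : L} (hS : Submodule.span K {x, y} ⊔ derived K L = ⊤)
    {k : ℕ} (v : Fin k → L × L) (hv : ∀ t, pairMap β x y (v t) = 0)
    (hli : ∀ c : Fin k → K, ∑ t, c t • v t = 0 → ∀ t, c t = 0) :
    Module.finrank K (Submodule.map₂ β ⊤ ⊤ : Submodule K Q) + k ≤ 2 * Module.finrank K L := by
  have h1 : k ≤ Module.finrank K (LinearMap.ker (pairMap β x y)) := by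
    have hl : LinearIndependent K v := Fintype.linearIndependent_iff.2 hli
    have hl' : LinearIndependent K (fun t => (⟨v t, hv t⟩ : LinearMap.ker (pairMap β x y))) :=
      LinearIndependent.of_comp (LinearMap.ker (pairMap β x y)).subtype hl
    simpa using hl'.fintype_card_le_finrank
  have h2 := LinearMap.finrank_range_add_finrank_ker (pairMap β x y)
  have h3 := Submodule.finrank_mono (hβ.map₂_le_range_pairMap hnil hS)
  rw [Module.finrank_prod] at h2
  omega

end Bound

/-! ### Cocycle relations involving odd squares -/

section Relations

variable {K L Q : Type*} [Field K] [AddCommGroup L] [Module K L] [LieSuperalgebra K L]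
  [AddCommGroup Q] [Module K Q]

namespace IsSuperCocycle

variable {β : L →ₗ[K] L →ₗ[K] Q} (hβ : IsSuperCocycle β)
include hβ

theorem skew_even_left {j : ZMod 2} {x y : L} (hx : x ∈ gr (K := K) 0) (hy : y ∈ gr (K := K) j) :
    β x y = -β y x := by
  rw [hβ.skew hx hy, superSign_zero_left, one_smul]

theorem symm_odd {x y : L} (hx : x ∈ gr (K := K) 1) (hy : y ∈ gr (K := K) 1) :
    β x y = β y x := by
  rw [hβ.skew hx hy, superSign_one_one, neg_one_smul, neg_neg]

theorem self_even (h2 : (2 : K) ≠ 0) {x : L} (hx : x ∈ gr (K := K) 0) : β x x = 0 := by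
  have h := hβ.skew_even_left hx hx
  rw [eq_neg_iff_add_eq_zero, ← two_smul K] at h
  exact (smul_eq_zero.1 h).resolve_left h2

/-- In the Jacobi identity for `x, y, y` the two terms on the right agree up to skew-symmetry, and
for odd `y` they add up instead of cancelling. -/
theorem odd_square_left {j : ZMod 2} {x y : L} (hx : x ∈ gr (K := K) j)
    (hy : y ∈ gr (K := K) 1) (hj : j = 0 ∨ j = 1) :
    β x (bracket (K := K) y y) =
      (superSign K j 1 * 2) • β y (bracket (K := K) x y) := by
  have h := hβ.jacobi hx hy hy
  have hxy := bracket_mem (K := K) hx hy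
  rcases hj with rfl | rfl
  · rw [h, hβ.symm_odd hxy hy, superSign_zero_left, one_smul, one_mul, two_smul]
  · rw [h, hβ.skew_even_left (j := 1) hxy hy, superSign_one_one]
    module

theorem even_odd_square {x y : L} (hx : x ∈ gr (K := K) 0) (hy : y ∈ gr (K := K) 1) :
    β x (bracket (K := K) y y) = (2 : K) • β y (bracket (K := K) x y) := by
  simpa [superSign_zero_left] using hβ.odd_square_left hx hy (Or.inl rfl)

theorem odd_odd_square {x y : L} (hx : x ∈ gr (K := K) 1) (hy : y ∈ gr (K := K) 1) :
    β x (bracket (K := K) y y) = -((2 : K) • β y (bracket (K := K) x y)) := by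
  simpa [superSign_one_one] using hβ.odd_square_left hx hy (Or.inr rfl)

/-- Taking `x = y` in the odd square relation, the value equals `-2` times itself, so three times it
vanishes. -/
theorem odd_cube (h3 : (3 : K) ≠ 0) {y : L} (hy : y ∈ gr (K := K) 1) :
    β y (bracket (K := K) y y) = 0 := by
  have h := hβ.odd_odd_square hy hy
  have h' : (3 : K) • β y (bracket (K := K) y y) = 0 := by
    rw [eq_neg_iff_add_eq_zero] at h
    rw [← h]
    module
  exact (smul_eq_zero.1 h').resolve_left h3

end IsSuperCocycle

theorem exists_eq_smul_of_add_eq_zero {V : Type*} [AddCommGroup V] [Module K V] {p q : K} {u v : V}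
    (hq : q ≠ 0) (h : p • u + q • v = 0) : ∃ t : K, v = t • u := by
  refine ⟨-(q⁻¹ * p), ?_⟩
  rw [neg_smul, mul_smul, eq_neg_of_add_eq_zero_left h, smul_neg, neg_neg, inv_smul_smul₀ hq]

theorem two_le_finrank_of_pair {V : Type*} [AddCommGroup V] [Module K V]
    {A : Submodule K V} [Module.Finite K A] {u v : V} (hu : u ∈ A)
    (hv : v ∈ A) (h : ∀ a b : K, a • u + b • v = 0 → a = 0 ∧ b = 0) :
    2 ≤ Module.finrank K A := by
  have hli : LinearIndependent K ![(⟨u, hu⟩ : A), ⟨v, hv⟩] :=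
    LinearIndependent.pair_iff.2 fun a b hab => h a b (congrArg Subtype.val hab)
  simpa using hli.fintype_card_le_finrank

theorem mem_span_pair_of_finrank_le_two {V : Type*} [AddCommGroup V] [Module K V]
    {A : Submodule K V} [Module.Finite K A] (hA : Module.finrank K A ≤ 2) {u v : V} (hu : u ∈ A)
    (hv : v ∈ A) (h : ∀ a b : K, a • u + b • v = 0 → a = 0 ∧ b = 0) {w : V} (hw : w ∈ A) :
    ∃ a b : K, a • u + b • v = w := by
  have hle : Submodule.span K {u, v} ≤ A := by
    rw [Submodule.span_le]
    rintro _ (rfl | rfl) <;> assumption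
  have hli : LinearIndependent K ![u, v] := LinearIndependent.pair_iff.2 h
  have hr := finrank_span_eq_card hli
  rw [Matrix.range_cons_cons_empty, Fintype.card_fin] at hr
  rw [← Submodule.eq_of_le_of_finrank_le hle (hA.trans hr.ge)] at hw
  exact Submodule.mem_span_pair.1 hw

end Relations

/-! ### Dimension bounds by parity of the generators -/

section Bounds

variable {K L Q : Type*} [Field K] [AddCommGroup L] [Module K L] [LieSuperalgebra K L]
  [Module.Finite K L] [AddCommGroup Q] [Module K Q]

/-- With `e = [y, y]` and `f = [x, y]`, the kernel of `pairMap` contains `(x, 0)`, `(y, x)`, `(0,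
e)` and `(e, -2f)`. If `e ≠ 0` these are four independent pairs and `n ≥ 2`. If `e = 0`, the last
two are lost as independent pairs, but `(0, f)` enters the kernel and `n ≥ 3`. -/
theorem finrank_map₂_le_of_even_odd (h2 : (2 : K) ≠ 0) (h3 : (3 : K) ≠ 0)
    {β : L →ₗ[K] L →ₗ[K] Q} (hβ : IsSuperCocycle β) (hnil : IsNilpotent K L) {x y : L}
    (hx : x ∈ gr (K := K) 0) (hy : y ∈ gr (K := K) 1)
    (hS : Submodule.span K {x, y} ⊔ derived K L = ⊤)
    (hind : ∀ a b : K, a • x + b • y ∈ derived K L → a = 0 ∧ b = 0)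
    (hd : 4 ≤ Module.finrank K L) :
    Module.finrank K (Submodule.map₂ β ⊤ ⊤ : Submodule K Q) + 6 ≤
      2 * Module.finrank K L + Module.finrank K (gr (K := K) (L := L) 1) := by
  classical
  set e := bracket (K := K) y y with he
  set f := bracket (K := K) x y with hf
  have hfg : f ∈ gr (K := K) (L := L) 1 := bracket_mem hx hy
  have heD : e ∈ derived K L := bracket_mem_derived y y
  have hfD : f ∈ derived K L := bracket_mem_derived x y
  have hL := isSuperCocycle_bracket (K := K) (L := L)
  have hyx : bracket (K := K) y x = -f := by rw [hf, hL.skew_even_left hx hy, neg_neg]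
  have hxx := hL.self_even h2 hx
  have hye := hL.odd_cube h3 hy
  have hxe := hL.even_odd_square hx hy
  rw [← he] at hye hxe
  rw [← hf] at hxe
  have v1 : pairMap β x y (x, 0) = 0 := by simp [pairMap_apply, hβ.self_even h2 hx]
  have v2 : pairMap β x y (y, x) = 0 := by simp [pairMap_apply, hβ.skew_even_left hx hy]
  have v3 : pairMap β x y (0, e) = 0 := by simp [pairMap_apply, he, hβ.odd_cube h3 hy]
  have v4 : pairMap β x y (e, -(2 : K) • f) = 0 := by
    simp [pairMap_apply, he, hf, hβ.even_odd_square hx hy]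
  have hyfi : f ≠ 0 → ∀ a b : K, a • y + b • f = 0 → a = 0 ∧ b = 0 := by
    intro hf0 a b hab
    have ha : a = 0 := (hind 0 a (by
      rw [zero_smul, zero_add, eq_neg_of_add_eq_zero_left hab]
      exact neg_mem (Submodule.smul_mem _ _ hfD))).2
    refine ⟨ha, ?_⟩
    rw [ha, zero_smul, zero_add] at hab
    exact (smul_eq_zero.1 hab).resolve_right hf0
  by_cases h0 : e = 0
  · have v5 : pairMap β x y (0, f) = 0 := by
      have := hβ.even_odd_square hx hy
      rw [← he, h0, map_zero, eq_comm] at this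
      simpa [pairMap_apply] using (smul_eq_zero.1 this).resolve_left h2
    have hyf : bracket (K := K) y f = 0 := by
      rw [h0, map_zero, eq_comm] at hxe
      exact (smul_eq_zero.1 hxe).resolve_left h2
    have hf0 : f ≠ 0 := by
      intro hf0
      have := finrank_le_of_stable_span hnil {x, y} hS (Submodule.subset_span (by simp))
        (Submodule.subset_span (by simp)) (by simp [hxx, ← hf, hf0])
        (by simp [hyx, hf0, ← he, h0])
      have := this.trans Finset.card_le_two
      omega
    -- Otherwise `y, f` span the odd part, so `[x, f]` is a combination of them; with `[y, f] = 0`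
    -- this makes the span of `x, y, f` stable, forcing `dim L ≤ 3`.
    have hn : 3 ≤ Module.finrank K (gr (K := K) (L := L) 1) := by
      by_contra! hn
      obtain ⟨a, b, hab⟩ := mem_span_pair_of_finrank_le_two (K := K) (by omega) hy hfg (hyfi hf0)
        (bracket_mem (K := K) hx hfg)
      have := finrank_le_of_stable_span hnil {x, y, f} hS (Submodule.subset_span (by simp))
        (Submodule.subset_span (by simp))
        (by
          have h1 : f ∈ Submodule.span K ({x, y, f} : Set L) := Submodule.subset_span (by simp)
          have h2 : y ∈ Submodule.span K ({x, y, f} : Set L) := Submodule.subset_span (by simp)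
          simp [hxx, ← hf, h1, ← hab, add_mem, Submodule.smul_mem, h2])
        (by
          have h1 : f ∈ Submodule.span K ({x, y, f} : Set L) := Submodule.subset_span (by simp)
          simp [hyx, ← he, h0, hyf, h1])
      have := this.trans Finset.card_le_three
      omega
    have := finrank_map₂_add_le hβ hnil hS ![(x, 0), (y, x), (0, f)]
      (by intro t; fin_cases t <;> assumption)
      (by
        intro c hc
        simp only [Fin.sum_univ_three, Matrix.cons_val_zero, Matrix.cons_val_one, Matrix.cons_val,
          Prod.smul_mk, Prod.mk_add_mk, smul_zero, add_zero, zero_add, Prod.mk_eq_zero] at hc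
        obtain ⟨hc1, hc2⟩ := hc
        obtain ⟨h0, h1⟩ := hind _ _ (by rw [hc1]; exact zero_mem _)
        rw [h1, zero_smul, zero_add] at hc2
        have h2 := (smul_eq_zero.1 hc2).resolve_right hf0
        intro t; fin_cases t <;> assumption)
    omega
  -- If `n = 1` then `f = 0`, whence `[x, e] = 2[y, f] = 0`. Also `[y, e] = 0`, so the span of `x,
  -- y, e` is stable.
  · have hn : 2 ≤ Module.finrank K (gr (K := K) (L := L) 1) := by
      by_contra! hn
      have hf0 : f = 0 := by
        by_contra hf0
        have := two_le_finrank_of_pair hy hfg (hyfi hf0)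
        omega
      have := finrank_le_of_stable_span hnil {x, y, e} hS (Submodule.subset_span (by simp))
        (Submodule.subset_span (by simp))
        (by simp [hxx, ← hf, hf0, hxe])
        (by
          have h1 : e ∈ Submodule.span K ({x, y, e} : Set L) := Submodule.subset_span (by simp)
          simp [hyx, ← he, hye, hf0, h1])
      have := this.trans Finset.card_le_three
      omega
    have := finrank_map₂_add_le hβ hnil hS ![(x, 0), (y, x), (0, e), (e, -(2 : K) • f)]
      (by intro t; fin_cases t <;> assumption)
      (by
        intro c hc
        simp only [Fin.sum_univ_four, Matrix.cons_val_zero, Matrix.cons_val_one, Matrix.cons_val,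
          Prod.smul_mk, Prod.mk_add_mk, smul_zero, add_zero, zero_add, Prod.mk_eq_zero] at hc
        obtain ⟨hc1, hc2⟩ := hc
        -- Modulo `L²` the first coordinate retains only the generators.
        obtain ⟨k0, k1⟩ := hind (c 0) (c 1) (by
          rw [eq_neg_of_add_eq_zero_left hc1]
          exact neg_mem (Submodule.smul_mem _ _ heD))
        rw [k0, k1, zero_smul, zero_smul, zero_add, zero_add] at hc1
        have k3 := (smul_eq_zero.1 hc1).resolve_right h0
        rw [k1, k3, zero_smul, zero_smul, zero_add, add_zero] at hc2
        have k2 := (smul_eq_zero.1 hc2).resolve_right h0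
        intro t; fin_cases t <;> assumption)
    omega

/-! ### Two odd generators -/

section OddGenerators

variable {y z : L} (hy : y ∈ gr (K := K) 1) (hz : z ∈ gr (K := K) 1)
  (hS : Submodule.span K {y, z} ⊔ derived K L = ⊤)
  (hind : ∀ a b : K, a • y + b • z ∈ derived K L → a = 0 ∧ b = 0)
include hy hz hind

/-- When `n ≤ 2` the odd part is spanned by `y, z` and so meets `L²` trivially, while the bracket is
odd and lies in `L²`. -/
theorem bracket_even_eq_zero_of_odd_generators
    (hn : Module.finrank K (gr (K := K) (L := L) 1) ≤ 2) {u w : L} (hu : u ∈ gr (K := K) 1)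
    (hw : w ∈ gr (K := K) 0) : bracket (K := K) u w = 0 := by
  obtain ⟨a, b, hab⟩ := mem_span_pair_of_finrank_le_two (K := K) hn hy hz
    (fun a b h => hind a b (by rw [h]; exact zero_mem _)) (bracket_mem (K := K) hu hw)
  obtain ⟨ha, hb⟩ := hind a b (by rw [hab]; exact bracket_mem_derived u w)
  rw [← hab, ha, hb, zero_smul, zero_smul, add_zero]

include hS

/-- If the odd part is spanned by the two generators, then the three brackets of the generators
do not all lie on one line. -/
theorem three_le_finrank_of_odd_generators (hnil : IsNilpotent K L)
    (hd : 4 ≤ Module.finrank K L) {s : L} (hs : s ∈ gr (K := K) 0)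
    (h11 : ∃ c : K, bracket (K := K) y y = c • s) (h12 : ∃ c : K, bracket (K := K) y z = c • s)
    (h22 : ∃ c : K, bracket (K := K) z z = c • s) :
    3 ≤ Module.finrank K (gr (K := K) (L := L) 1) := by
  classical
  by_contra! hn
  obtain ⟨c1, h11⟩ := h11
  obtain ⟨c2, h12⟩ := h12
  obtain ⟨c3, h22⟩ := h22
  have h21 := (isSuperCocycle_bracket (K := K) (L := L)).symm_odd hz hy
  have hsW : s ∈ Submodule.span K ({y, z, s} : Set L) := Submodule.subset_span (by simp)
  have hys := bracket_even_eq_zero_of_odd_generators hy hz hind (by omega) hy hs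
  have hzs := bracket_even_eq_zero_of_odd_generators hy hz hind (by omega) hz hs
  have := finrank_le_of_stable_span hnil {y, z, s} hS (Submodule.subset_span (by simp))
    (Submodule.subset_span (by simp))
    (by simp [h11, h12, hys, Submodule.smul_mem, hsW])
    (by simp [h21, h22, h12, hzs, Submodule.smul_mem, hsW])
  have := this.trans Finset.card_le_three
  omega

/-- With `a = [y, y]`, `b = [y, z]`, `c = [z, z]`, the pairs `(z, -y)`, `(a, 0)`, `(2b, a)` in the
kernel are always independent when `a ≠ 0`. A fourth is `(0, c)` if `c` is off the line of `a`, or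
`(c, 2b)` if `c` is on it but `b` is not. If both lie on that line, then `n ≥ 3` and three pairs
suffice. -/
theorem finrank_map₂_le_of_odd_square_ne_zero (h2 : (2 : K) ≠ 0) (h3 : (3 : K) ≠ 0)
    {β : L →ₗ[K] L →ₗ[K] Q} (hβ : IsSuperCocycle β) (hnil : IsNilpotent K L)
    (hd : 4 ≤ Module.finrank K L) (ha : bracket (K := K) y y ≠ 0) :
    Module.finrank K (Submodule.map₂ β ⊤ ⊤ : Submodule K Q) + 6 ≤
      2 * Module.finrank K L + Module.finrank K (gr (K := K) (L := L) 1) := by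
  set a := bracket (K := K) y y with ha'
  set b := bracket (K := K) y z with hb'
  set c := bracket (K := K) z z with hc'
  have hag : a ∈ gr (K := K) (L := L) 0 := bracket_mem hy hy
  have haD : a ∈ derived K L := bracket_mem_derived y y
  have hbD : b ∈ derived K L := bracket_mem_derived y z
  have hzy : bracket (K := K) z y = b :=
    (isSuperCocycle_bracket (K := K) (L := L)).symm_odd hz hy
  have v1 : pairMap β y z (z, -y) = 0 := by simp [pairMap_apply, hβ.symm_odd hy hz]
  have v2 : pairMap β y z (a, 0) = 0 := by simp [pairMap_apply, ha', hβ.odd_cube h3 hy]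
  have v3 : pairMap β y z (0, c) = 0 := by simp [pairMap_apply, hc', hβ.odd_cube h3 hz]
  have v4 : pairMap β y z ((2 : K) • b, a) = 0 := by
    simp [pairMap_apply, ha', hβ.odd_odd_square hz hy, hzy]
  have v5 : pairMap β y z (c, (2 : K) • b) = 0 := by
    simp [pairMap_apply, hc', hβ.odd_odd_square hy hz, hb']
  have hp : ∀ p : K, ∀ w ∈ derived K L, p • z + w = 0 → p = 0 := by
    intro p w hw h
    refine (hind 0 p ?_).2
    rw [zero_smul, zero_add, eq_neg_of_add_eq_zero_left h]
    exact neg_mem hw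
  have hn2 : 2 ≤ Module.finrank K (gr (K := K) (L := L) 1) :=
    two_le_finrank_of_pair hy hz fun a b h => hind a b (by rw [h]; exact zero_mem _)
  by_cases hca : ∃ t : K, c = t • a
  · by_cases hba : ∃ t : K, b = t • a
    · have hn := three_le_finrank_of_odd_generators hy hz hS hind hnil hd hag
        ⟨1, (one_smul K a).symm⟩ hba hca
      have := finrank_map₂_add_le hβ hnil hS ![(z, -y), (a, 0), ((2 : K) • b, a)]
        (by intro t; fin_cases t <;> assumption)
        (by
          intro r hr
          simp only [Fin.sum_univ_three, Matrix.cons_val_zero, Matrix.cons_val_one, Matrix.cons_val,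
            Prod.smul_mk, Prod.mk_add_mk, smul_zero, add_zero, smul_neg, Prod.mk_eq_zero] at hr
          obtain ⟨hr1, hr2⟩ := hr
          -- Modulo `L²` only the multiple of `z` survives in the first coordinate; afterwards `a ≠
          -- 0` settles the second.
          have k0 := hp _ _ (add_mem (Submodule.smul_mem _ (r 1) haD)
            (Submodule.smul_mem _ (r 2) (Submodule.smul_mem _ (2 : K) hbD)))
            (by rw [← add_assoc]; exact hr1)
          rw [k0, zero_smul, neg_zero, zero_add] at hr2
          have k2 := (smul_eq_zero.1 hr2).resolve_right ha
          rw [k0, k2, zero_smul, zero_smul, zero_add, add_zero] at hr1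
          have k1 := (smul_eq_zero.1 hr1).resolve_right ha
          intro t; fin_cases t <;> assumption)
      omega
    · obtain ⟨t, ht⟩ := hca
      have := finrank_map₂_add_le hβ hnil hS
        ![(z, -y), (a, 0), ((2 : K) • b, a), (c, (2 : K) • b)]
        (by intro t; fin_cases t <;> assumption)
        (by
          intro r hr
          simp only [Fin.sum_univ_four, Matrix.cons_val_zero, Matrix.cons_val_one, Matrix.cons_val,
            Prod.smul_mk, Prod.mk_add_mk, smul_zero, add_zero, smul_neg, Prod.mk_eq_zero] at hr
          obtain ⟨hr1, hr2⟩ := hr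
          have k0 := hp _ _ (add_mem (add_mem (Submodule.smul_mem _ (r 1) haD)
            (Submodule.smul_mem _ (r 2) (Submodule.smul_mem _ (2 : K) hbD)))
            (Submodule.smul_mem _ (r 3) (bracket_mem_derived z z)))
            (by rw [← add_assoc, ← add_assoc]; exact hr1)
          rw [k0, zero_smul, neg_zero, zero_add] at hr2
          have k3 : r 3 = 0 := by
            by_contra k3
            rw [smul_smul] at hr2
            exact hba (exists_eq_smul_of_add_eq_zero (mul_ne_zero k3 h2) hr2)
          rw [k3, zero_smul, add_zero] at hr2
          have k2 := (smul_eq_zero.1 hr2).resolve_right ha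
          rw [k0, k2, k3, zero_smul, zero_smul, zero_smul, zero_add, add_zero, add_zero] at hr1
          have k1 := (smul_eq_zero.1 hr1).resolve_right ha
          intro t; fin_cases t <;> assumption)
      omega
  · have := finrank_map₂_add_le hβ hnil hS
      ![(z, -y), (a, 0), ((2 : K) • b, a), (0, c)]
      (by intro t; fin_cases t <;> assumption)
      (by
        intro r hr
        simp only [Fin.sum_univ_four, Matrix.cons_val_zero, Matrix.cons_val_one, Matrix.cons_val,
          Prod.smul_mk, Prod.mk_add_mk, smul_zero, add_zero, smul_neg, Prod.mk_eq_zero] at hr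
        obtain ⟨hr1, hr2⟩ := hr
        have k0 := hp _ _ (add_mem (Submodule.smul_mem _ (r 1) haD)
          (Submodule.smul_mem _ (r 2) (Submodule.smul_mem _ (2 : K) hbD)))
          (by rw [← add_assoc]; exact hr1)
        rw [k0, zero_smul, neg_zero, zero_add] at hr2
        have k3 : r 3 = 0 := by
          by_contra k3
          exact hca (exists_eq_smul_of_add_eq_zero k3 hr2)
        rw [k3, zero_smul, add_zero] at hr2
        have k2 := (smul_eq_zero.1 hr2).resolve_right ha
        rw [k0, k2, zero_smul, zero_smul, zero_add, add_zero] at hr1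
        have k1 := (smul_eq_zero.1 hr1).resolve_right ha
        intro t; fin_cases t <;> assumption)
    omega

end OddGenerators

/-- If one generator has nonzero square, the previous bound applies up to exchanging the two. If
both squares vanish, the odd square relations put `(b, 0)` and `(0, b)` in the kernel, with `b = [y,
z] ≠ 0`; together with `(z, -y)` and `n ≥ 3` this is enough. -/
theorem finrank_map₂_le_of_odd_odd (h2 : (2 : K) ≠ 0) (h3 : (3 : K) ≠ 0)
    {β : L →ₗ[K] L →ₗ[K] Q} (hβ : IsSuperCocycle β) (hnil : IsNilpotent K L) {y z : L}
    (hy : y ∈ gr (K := K) 1) (hz : z ∈ gr (K := K) 1)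
    (hS : Submodule.span K {y, z} ⊔ derived K L = ⊤)
    (hind : ∀ a b : K, a • y + b • z ∈ derived K L → a = 0 ∧ b = 0)
    (hd : 4 ≤ Module.finrank K L) :
    Module.finrank K (Submodule.map₂ β ⊤ ⊤ : Submodule K Q) + 6 ≤
      2 * Module.finrank K L + Module.finrank K (gr (K := K) (L := L) 1) := by
  by_cases ha : bracket (K := K) y y = 0
  swap
  · exact finrank_map₂_le_of_odd_square_ne_zero hy hz hS hind h2 h3 hβ hnil hd ha
  by_cases hc : bracket (K := K) z z = 0
  swap
  · refine finrank_map₂_le_of_odd_square_ne_zero hz hy (by rwa [Set.pair_comm])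
      (fun a b h => (hind b a (by rwa [add_comm])).symm) h2 h3 hβ hnil hd hc
  set b := bracket (K := K) y z with hb'
  have hbD : b ∈ derived K L := bracket_mem_derived y z
  have hzy : bracket (K := K) z y = b :=
    (isSuperCocycle_bracket (K := K) (L := L)).symm_odd hz hy
  have hn := three_le_finrank_of_odd_generators hy hz hS hind hnil hd
    (bracket_mem (K := K) hy hz) ⟨0, by rw [ha, zero_smul]⟩ ⟨1, by rw [one_smul]⟩
    ⟨0, by rw [hc, zero_smul]⟩
  have hb : b ≠ 0 := by
    classical
    intro hb
    have := finrank_le_of_stable_span hnil {y, z} hS (Submodule.subset_span (by simp))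
      (Submodule.subset_span (by simp)) (by simp [ha, ← hb', hb]) (by simp [hzy, hb, hc])
    have := this.trans Finset.card_le_two
    omega
  have v1 : pairMap β y z (z, -y) = 0 := by simp [pairMap_apply, hβ.symm_odd hy hz]
  have v2 : pairMap β y z (b, 0) = 0 := by
    have := hβ.odd_odd_square hz hy
    rw [ha, map_zero, eq_comm, neg_eq_zero, hzy] at this
    simpa [pairMap_apply] using (smul_eq_zero.1 this).resolve_left h2
  have v3 : pairMap β y z (0, b) = 0 := by
    have := hβ.odd_odd_square hy hz
    rw [hc, map_zero, eq_comm, neg_eq_zero, ← hb'] at this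
    simpa [pairMap_apply] using (smul_eq_zero.1 this).resolve_left h2
  have := finrank_map₂_add_le hβ hnil hS ![(z, -y), (b, 0), (0, b)]
    (by intro t; fin_cases t <;> assumption)
    (by
      intro r hr
      simp only [Fin.sum_univ_three, Matrix.cons_val_zero, Matrix.cons_val_one, Matrix.cons_val,
        Prod.smul_mk, Prod.mk_add_mk, smul_zero, add_zero, smul_neg, Prod.mk_eq_zero] at hr
      obtain ⟨hr1, hr2⟩ := hr
      have k0 : r 0 = 0 := (hind 0 (r 0) (by
        rw [zero_smul, zero_add, eq_neg_of_add_eq_zero_left hr1]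
        exact neg_mem (Submodule.smul_mem _ _ hbD))).2
      rw [k0, zero_smul, zero_add] at hr1
      rw [k0, zero_smul, neg_zero, zero_add] at hr2
      have k1 := (smul_eq_zero.1 hr1).resolve_right hb
      have k2 := (smul_eq_zero.1 hr2).resolve_right hb
      intro t; fin_cases t <;> assumption)
  omega

theorem finrank_map₂_le (h2 : (2 : K) ≠ 0) (h3 : (3 : K) ≠ 0)
    {β : L →ₗ[K] L →ₗ[K] Q} (hβ : IsSuperCocycle β) (hnil : IsNilpotent K L)
    (hd : 4 ≤ Module.finrank K L) (hn : 1 ≤ Module.finrank K (gr (K := K) (L := L) 1))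
    (hgen : Module.finrank K (L ⧸ derived K L) = 2) :
    Module.finrank K (Submodule.map₂ β ⊤ ⊤ : Submodule K Q) + 6 ≤
      2 * Module.finrank K L + Module.finrank K (gr (K := K) (L := L) 1) := by
  obtain ⟨i, j, x, y, hx, hy, hS, hind⟩ := exists_homogeneous_generators hgen
  have h01 : ∀ i : ZMod 2, i = 0 ∨ i = 1 := by decide
  rcases h01 i with rfl | rfl <;> rcases h01 j with rfl | rfl
  -- The even part contains both generators and is stable under them, so it is all of `L`, against
  -- `n ≥ 1`.
  · have htop := eq_top_of_stable_pair hnil hS hx hy (fun w hw => bracket_mem (K := K) hx hw)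
      (fun w hw => bracket_mem (K := K) hy hw)
    have hbot : gr (K := K) (L := L) 1 = ⊥ := by
      have := (isCompl_gr (K := K) (L := L)).disjoint
      rwa [htop, top_disjoint] at this
    rw [hbot, finrank_bot] at hn
    omega
  · exact finrank_map₂_le_of_even_odd h2 h3 hβ hnil hx hy hS hind hd
  · exact finrank_map₂_le_of_even_odd h2 h3 hβ hnil hy hx (by rwa [Set.pair_comm])
      (fun a b h => (hind b a (by rwa [add_comm])).symm) hd
  · exact finrank_map₂_le_of_odd_odd h2 h3 hβ hnil hx hy hS hind hd

/-- The bound for the kernel of `E² / [R, E] → L²`, where `R` is the kernel of an epimorphism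
`E → L`. -/
theorem Hom.finrank_multiplier_add_le {E : Type*} [AddCommGroup E] [Module K E]
    [LieSuperalgebra K E] (π : Hom K E L) (hπ : Function.Surjective π.toLin)
    (h2 : (2 : K) ≠ 0) (h3 : (3 : K) ≠ 0) (hnil : IsNilpotent K L)
    (hd : 4 ≤ Module.finrank K L) (hn : 1 ≤ Module.finrank K (gr (K := K) (L := L) 1))
    (hgen : Module.finrank K (L ⧸ derived K L) = 2) :
    Module.Finite K (↥(LinearMap.ker π.toLin ⊓ derived K E) ⧸
        (bracketSpan K (LinearMap.ker π.toLin) ⊤).submoduleOf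
          (LinearMap.ker π.toLin ⊓ derived K E)) ∧
      Module.finrank K (↥(LinearMap.ker π.toLin ⊓ derived K E) ⧸
        (bracketSpan K (LinearMap.ker π.toLin) ⊤).submoduleOf
          (LinearMap.ker π.toLin ⊓ derived K E)) + 4 ≤
      Module.finrank K L + Module.finrank K (gr (K := K) (L := L) 1) := by
  set R := LinearMap.ker π.toLin
  set I := bracketSpan K R ⊤
  obtain ⟨β, hβ, hβmk⟩ : ∃ β : L →ₗ[K] L →ₗ[K] E ⧸ I, IsSuperCocycle β ∧
    ∀ a b : E, β (π.toLin a) (π.toLin b) = I.mkQ (bracket (K := K) a b) := π.exists_cocycle hπ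
  have hbound := finrank_map₂_le h2 h3 hβ hnil hd hn hgen
  -- The span of the values of `β` is the image of `E²` in `E/[R, E]`.
  have hV : Submodule.map₂ β ⊤ ⊤ = (derived K E).map I.mkQ := by
    have htop : (⊤ : Submodule K L) = Submodule.map π.toLin ⊤ := by
      rw [Submodule.map_top, LinearMap.range_eq_top.2 hπ]
    rw [htop, Submodule.map₂_map_map]
    unfold derived bracketSpan
    rw [Submodule.map_map₂]
    congr 1
    ext a b
    exact hβmk _ _
  set V := Submodule.map₂ β ⊤ ⊤
  have hVfin : Module.Finite K V :=
    Module.Finite.iff_fg.2 (Submodule.FG.map₂ _ Module.Finite.fg_top Module.Finite.fg_top)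
  have hIR : I ≤ R := by
    refine Submodule.map₂_le.2 fun r hr f _ => ?_
    have hr' : π.toLin r = 0 := hr
    change π.toLin _ = 0
    rw [π.map_bracket, hr', map_zero, LinearMap.zero_apply]
  let ψ : E ⧸ I →ₗ[K] L := I.liftQ π.toLin hIR
  have hψV : LinearMap.range (ψ.domRestrict V) = derived K L := by
    have htop : (⊤ : Submodule K L) = Submodule.map π.toLin ⊤ := by
      rw [Submodule.map_top, LinearMap.range_eq_top.2 hπ]
    rw [LinearMap.range_domRestrict, hV, ← Submodule.map_comp, Submodule.liftQ_mkQ]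
    unfold derived bracketSpan
    rw [htop, Submodule.map_map₂, Submodule.map₂_map_map]
    congr 1
    ext a b
    exact π.map_bracket _ _
  have hrank := LinearMap.finrank_range_add_finrank_ker (ψ.domRestrict V)
  rw [hψV] at hrank
  have hquot := Submodule.finrank_quotient_add_finrank (derived K L)
  let j : (↥(R ⊓ derived K E) ⧸ I.submoduleOf (R ⊓ derived K E)) →ₗ[K] E ⧸ I := 
    Submodule.mapQ _ I (R ⊓ derived K E).subtype le_rfl
  have hj : Function.Injective j := by
    rw [← LinearMap.ker_eq_bot]
    exact Submodule.ker_liftQ_eq_bot _ _ _ (by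
      rw [LinearMap.ker_comp, Submodule.ker_mkQ]
      exact le_rfl)
  have hjV : ∀ t, j t ∈ V := by
    intro t
    obtain ⟨⟨r, hr⟩, rfl⟩ := Submodule.mkQ_surjective _ t
    rw [hV]
    exact ⟨r, hr.2, rfl⟩
  -- The multiplier embeds in the kernel of `V → L²`, whose dimension is `dim V - dim L²`.
  let j' : (↥(R ⊓ derived K E) ⧸ I.submoduleOf (R ⊓ derived K E)) →ₗ[K]
      LinearMap.ker (ψ.domRestrict V) :=
    (j.codRestrict V hjV).codRestrict _ fun t => by
      obtain ⟨⟨r, hr⟩, rfl⟩ := Submodule.mkQ_surjective _ t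
      exact hr.1
  have hj' : Function.Injective j' := fun s t hst =>
    hj (congrArg (fun z : LinearMap.ker (ψ.domRestrict V) => ((z : V) : E ⧸ I)) hst)
  refine ⟨Module.Finite.of_injective j' hj', ?_⟩
  have := LinearMap.finrank_le_finrank_of_injective hj'
  omega

end Bounds

end LieSuperalgebra

-- The bound for the Schur multiplier

universe u v w

theorem theorem2p3 {K : Type u} [Field K] (h2 : (2 : K) ≠ 0) (h3 : (3 : K) ≠ 0)
    {L : Type v} [AddCommGroup L] [Module K L] [LieSuperalgebra K L]
    (m n : ℕ) (hdim : LieSuperalgebra.HasSuperdim K L m n)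
    (hnil : LieSuperalgebra.IsNilpotent K L)
    (hmn : 4 ≤ m + n) (hn : 1 ≤ n)
    (hder : Module.finrank K (LieSuperalgebra.derived K L) = m + n - 2)
    (P : LieSuperalgebra.FreePresentation.{u, v, w} K L) :
    Module.Finite K P.SchurMultiplier ∧
      (Module.finrank K P.SchurMultiplier : ℤ) < (m : ℤ) + 2 * (n : ℤ) - 3 := by
  open LieSuperalgebra in
  have hfin : Module.Finite K L := hdim.1
  have hL := finrank_of_hasSuperdim hdim
  have hn1 : Module.finrank K (gr (K := K) (L := L) 1) = n := hdim.2.2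
  -- The truncated subtraction `m + n - 2` is genuine because `m + n ≥ 4`.
  have hgen : Module.finrank K (L ⧸ derived K L) = 2 := by
    have := Submodule.finrank_quotient_add_finrank (derived K L)
    omega
  obtain ⟨hM, hb⟩ := P.π.finrank_multiplier_add_le P.surj h2 h3 hnil (by omega) (by omega) hgen
  refine ⟨hM, ?_⟩
  change (Module.finrank K P.SchurMultiplier) + 4 ≤ _ at hb
  omega
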